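/- All graphs are finite and simple. Quasi-threshold graphs form the smallest isomorphism-closed class that contains the one-vertex graph and is closed under adding a new vertex adjacent to all existing vertices and under disjoint union of two graphs. A vertex of a graph $G$ is simplicial if its neighbours form a clique. A set $S$ of vertices is a minimal vertex separator of $G$ if there are non-adjacent vertices $u,v\notin S$ lying in distinct connected components of $G-S$, such that no proper subset of $S$ separates $u$ and $v$ in this sense. A clique-tree of $G$ is a tree $T$ whose vertices are the (inclusion-)maximal cliques of $G$ such that, for all maximal cliques $Q,Q'$, every clique on the path from $Q$ to $Q'$ in $T$ contains $Q\cap Q'$. The multiplicity $\mu(S)$ of a minimal vertex separator $S$ is the number of edges $\{Q,Q'\}$ of a clique-tree of $G$ with $Q\cap Q'=S$. Theorem. Let $G$ be a connected quasi-threshold graph. Let $\mathbb{Q}$ be its set of maximal cliques, $\mathbb{S}$ its set of minimal vertex separators and, for $Q\in\mathbb{Q}$, let $\mathrm{Simp}(Q)$ be the set of vertices of $Q$ that are simplicial in $G$. Then $G$ has a clique-tree, the multiset of the intersections $Q\cap Q'$ over its edges (hence $\mu$) does not depend on the choice of the clique-tree, and the nonzero eigenvalues of the Laplacian matrix $L(G)=D(G)-A(G)$,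 listed with multiplicity, are exactly (a) $d_G(v)+1$, once for each non-simplicial vertex $v$; (b) $|Q|$, repeated $|\mathrm{Simp}(Q)|-1$ times, for each $Q\in\mathbb{Q}$; (c) $|S|$, repeated $\mu(S)$ times, for each $S\in\mathbb{S}$. The repetitions of equal values coming from different vertices, cliques or separators, and from (a), (b) and (c), add up. -/

import Mathlib

noncomputable section

namespace QuasiThreshold

universe u

variable {V : Type u}

/-- The graph obtained from `G` by adding one new vertex (`none`) adjacent to all vertices
of `G`. -/
def addUniversal (G : SimpleGraph V) : SimpleGraph (Option V) where
  Adj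
    | none, none => False
    | none, some _ => True
    | some _, none => True
    | some a, some b => G.Adj a b
  symm := ⟨by
    rintro (_ | a) (_ | b) h
    · exact h
    · trivial
    · trivial
    · exact G.adj_symm h⟩
  loopless := ⟨by
    rintro (_ | a) h
    · exact h
    · exact G.loopless.irrefl a h⟩

/-- Quasi-threshold graphs, as the smallest isomorphism-closed class of graphs that contains the
one-vertex graph and is closed under adding a universal vertex and under disjoint unions of two
graphs. -/
inductive IsQuasiThreshold : {V : Type u} → SimpleGraph V → Prop
  | isolated : IsQuasiThreshold (⊥ : SimpleGraph PUnit.{u + 1})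
  | universal {V : Type u} (G : SimpleGraph V) :
      IsQuasiThreshold G → IsQuasiThreshold (addUniversal G)
  | disjointUnion {V W : Type u} (G : SimpleGraph V) (H : SimpleGraph W) :
      IsQuasiThreshold G → IsQuasiThreshold H → IsQuasiThreshold (G.sum H)
  | iso {V W : Type u} (G : SimpleGraph V) (H : SimpleGraph W) :
      Nonempty (G ≃g H) → IsQuasiThreshold G → IsQuasiThreshold H

/-- A vertex is simplicial when its neighbourhood is a clique. -/
def IsSimplicial (G : SimpleGraph V) (v : V) : Prop := G.IsClique (G.neighborSet v)

/-- `Q` is a maximal (with respect to inclusion) clique of `G`. -/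
def IsMaxClique (G : SimpleGraph V) (Q : Finset V) : Prop := Maximal G.IsClique (Q : Set V)

/-- `S` is a `uv`-separator, for the non-adjacent vertices `u` and `v`: they are not in `S`, and
lie in distinct connected components of the graph `G - S`. -/
def IsVertexSeparator (G : SimpleGraph V) (u v : V) (S : Finset V) : Prop :=
  u ≠ v ∧ ¬ G.Adj u v ∧ ∃ (hu : u ∉ S) (hv : v ∉ S),
    ¬ (G.induce {x : V | x ∉ S}).Reachable ⟨u, hu⟩ ⟨v, hv⟩

/-- `S` is a minimal vertex separator: for some pair `u`, `v` of non-adjacent vertices, it is a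
`uv`-separator none of whose proper subsets is a `uv`-separator. -/
def IsMinimalVertexSeparator (G : SimpleGraph V) (S : Finset V) : Prop :=
  ∃ u v : V, IsVertexSeparator G u v S ∧ ∀ S' : Finset V, S' ⊂ S → ¬ IsVertexSeparator G u v S'

/-- A clique-tree of `G`: a tree `T` whose vertices are the maximal cliques of `G` such that every
clique on the path of `T` from `Q` to `Q'` contains `Q ∩ Q'`. -/
structure IsCliqueTree (G : SimpleGraph V) (T : SimpleGraph {Q : Finset V // IsMaxClique G Q}) :
    Prop where
  isTree : T.IsTree
  inter_subset : ∀ (Q Q' : {Q : Finset V // IsMaxClique G Q}) (p : T.Walk Q Q'), p.IsPath →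
    ∀ R ∈ p.support, ∀ x : V, x ∈ Q.1 → x ∈ Q'.1 → x ∈ R.1

section Finite

variable [Fintype V]

open Classical in
/-- The set of maximal cliques of `G`. -/
def maxCliques (G : SimpleGraph V) : Finset (Finset V) :=
  Finset.univ.filter fun Q => IsMaxClique G Q

open Classical in
/-- The set of minimal vertex separators of `G`. -/
def minimalVertexSeparators (G : SimpleGraph V) : Finset (Finset V) :=
  Finset.univ.filter fun S => IsMinimalVertexSeparator G S

open Classical in
/-- The set of vertices of `Q` that are simplicial in `G`. -/
def simplicialIn (G : SimpleGraph V) (Q : Finset V) : Finset V := Q.filter fun v => IsSimplicial G v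

open Classical in
/-- The set of vertices of `G` that are not simplicial. -/
def nonSimplicial (G : SimpleGraph V) : Finset V :=
  Finset.univ.filter fun v => ¬ IsSimplicial G v

open Classical in
/-- The multiset of the intersections `Q ∩ Q'`, for `{Q, Q'}` running over the edges of `T`. -/
def edgeIntersections (G : SimpleGraph V) (T : SimpleGraph {Q : Finset V // IsMaxClique G Q}) :
    Multiset (Finset V) :=
  T.edgeFinset.val.map
    (Sym2.lift ⟨fun Q Q' => Q.1 ∩ Q'.1, fun Q Q' => Finset.inter_comm Q.1 Q'.1⟩)

open Classical in
/-- The multiplicity `μ(S)` of `S`, read off the clique-tree `T`: the number of edges `{Q, Q'}`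
of `T` with `Q ∩ Q' = S`. -/
def multiplicity (G : SimpleGraph V) (T : SimpleGraph {Q : Finset V // IsMaxClique G Q})
    (S : Finset V) : ℕ :=
  (edgeIntersections G T).count S

/-- The Laplacian eigenvalues of `G`, repeated according to their multiplicities. -/
def laplacianEigenvalues [DecidableEq V] (G : SimpleGraph V) [DecidableRel G.Adj] : Multiset ℝ :=
  Finset.univ.val.map (G.isHermitian_lapMatrix ℝ).eigenvalues

end Finite

end QuasiThreshold

end

/-! Induction over the class, on a statement that also covers disconnected graphs: the roots of the
Laplacian characteristic polynomial are one 0 together with the values (a), (b), (c) read off some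
join tree of the maximal cliques.

For a disjoint union, the two join trees are linked by one edge. Its intersection is empty, so it
contributes the value 0, which is exactly the extra zero eigenvalue of the union. For a universal
vertex added to a graph on n vertices, `charpoly_lapMatrix_addUniversal` keeps one root 0, adds the
root n + 1 and shifts the other roots by 1. Likewise degrees, cliques and intersections all grow by
one; the new n + 1 is of type (a), or of type (b) when the old graph is complete.

The choice of tree is immaterial: the cliques containing a set S span a subtree, so the number of
edges whose intersection contains S is fixed by the cliques alone (`IsJoinTree.card_filter_subset`),
and these numbers determine the multiset of intersections. Each intersection is a minimal vertex
separator, so the multiset regroups over the separators. Connectedness enters only at the end: it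
makes the intersections nonempty, so that no listed value is 0.

Families of cliques are indexed by an arbitrary type so that the induction can work on sums of index
types. -/

namespace QuasiThreshold

open SimpleGraph Polynomial

/-! ### Join trees and the uniqueness of their edge intersections -/

/-- `B` enumerates, without repetition, the maximal cliques of `G`. -/
structure IsCliqueEnumeration {V ι : Type*} (G : SimpleGraph V) (B : ι → Finset V) : Prop where
  isClique : ∀ i, G.IsClique (B i : Set V)
  exists_subset : ∀ K : Set V, G.IsClique K → ∃ i, K ⊆ B i
  eq_of_subset : ∀ i j, B i ⊆ B j → i = j

/-- `T` is a join tree of the family `B`: the indices of the sets that contain a given element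
span a connected subgraph of `T`. -/
structure IsJoinTree {V ι : Type*} (B : ι → Finset V) (T : SimpleGraph ι) : Prop where
  isTree : T.IsTree
  exists_walk : ∀ i j x, x ∈ B i → x ∈ B j → ∃ p : T.Walk i j, ∀ k ∈ p.support, x ∈ B k

/-- The unique path of a tree is the bypass of any walk with the same ends. Hence `IsJoinTree` may
ask for just some walk, which is easier to construct. -/
theorem IsJoinTree.mem_of_mem_support {V ι : Type*} {B : ι → Finset V} {T : SimpleGraph ι}
    (h : IsJoinTree B T) {i j k : ι} {p : T.Walk i j} (hp : p.IsPath) (hk : k ∈ p.support) {x : V}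
    (hi : x ∈ B i) (hj : x ∈ B j) : x ∈ B k := by
  classical
  obtain ⟨q, hq⟩ := h.exists_walk i j x hi hj
  have : p = q.bypass := (h.isTree.existsUnique_path i j).unique hp q.bypass_isPath
  exact hq k (q.support_bypass_subset_support (this ▸ hk))

theorem isCliqueTree_iff_isJoinTree {V : Type*} {G : SimpleGraph V}
    {T : SimpleGraph {Q : Finset V // IsMaxClique G Q}} :
    IsCliqueTree G T ↔ IsJoinTree Subtype.val T := by
  constructor
  · intro h
    refine ⟨h.isTree, fun i j x hi hj => ?_⟩
    obtain ⟨p, hp, -⟩ := h.isTree.existsUnique_path i j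
    exact ⟨p, fun k hk => h.inter_subset i j p hp k hk x hi hj⟩
  · intro h
    exact ⟨h.isTree, fun i j p hp k hk x hi hj => h.mem_of_mem_support hp hk hi hj⟩

open Classical in
/-- The intersection of the two sets of the family `B` at the ends of an edge. -/
noncomputable def edgeInter {V ι : Type*} (B : ι → Finset V) : Sym2 ι → Finset V :=
  Sym2.lift ⟨fun i j => B i ∩ B j, fun i j => Finset.inter_comm (B i) (B j)⟩

theorem mem_edgeInter {V ι : Type*} {B : ι → Finset V} {i j : ι} {x : V} :
    x ∈ edgeInter B s(i, j) ↔ x ∈ B i ∧ x ∈ B j := by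
  simp [edgeInter]

open Classical in
/-- The intersections of the pairs of sets at the ends of the edges of `T`. -/
noncomputable def treeIntersections {V ι : Type*} [Fintype ι] (B : ι → Finset V) (T : SimpleGraph ι) :
    Multiset (Finset V) :=
  T.edgeFinset.val.map (edgeInter B)

open Classical in
theorem edgeIntersections_eq {V : Type*} [Fintype V] {G : SimpleGraph V}
    (T : SimpleGraph {Q : Finset V // IsMaxClique G Q}) :
    edgeIntersections G T = treeIntersections Subtype.val T := rfl

-- The sets containing S index a subtree, whose edges are those with intersection containing S; a
-- nonempty tree has one edge fewer than vertices.
open Classical in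
theorem IsJoinTree.card_filter_subset {V ι : Type*} [Fintype ι] {B : ι → Finset V}
    {T : SimpleGraph ι} (h : IsJoinTree B T) (S : Finset V) :
    (treeIntersections B T).countP (S ⊆ ·) = (Finset.univ.filter (S ⊆ B ·)).card - 1 := by
  set s := Finset.univ.filter (S ⊆ B ·) with hs
  have hcount : (treeIntersections B T).countP (S ⊆ ·) = (T.induce (s : Set ι)).edgeFinset.card := by
    rw [← card_filter_edgeFinset_toFinset_subset, treeIntersections, Multiset.countP_map,
      Finset.card_def, Finset.filter_val]
    congr 1
    refine Multiset.filter_congr fun e _ => ?_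
    induction e with | _ i j =>
    simp only [Finset.subset_iff, mem_edgeInter, hs, Sym2.mem_toFinset, Sym2.mem_iff,
      Finset.mem_filter, Finset.mem_univ, true_and, forall_eq_or_imp, forall_eq]
    exact forall₂_and
  rw [hcount]
  -- With no set containing S, the truncated 0 - 1 = 0 is the correct count.
  rcases s.eq_empty_or_nonempty with h0 | ⟨i₀, hi₀⟩
  · have : (T.induce (s : Set ι)).edgeFinset = ∅ := by
      ext e
      induction e with | _ i j =>
      have := i.2
      simp [h0] at this
    rw [this, h0]
    rfl
  · have hconn : (T.induce (s : Set ι)).Connected := by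
      rw [connected_iff]
      refine ⟨fun i j => ?_, ⟨⟨i₀, hi₀⟩⟩⟩
      obtain ⟨p, hp, -⟩ := h.isTree.existsUnique_path i.1 j.1
      refine ⟨p.induce _ fun k hk => ?_⟩
      have hi : S ⊆ B i := (Finset.mem_filter.1 i.2).2
      have hj : S ⊆ B j := (Finset.mem_filter.1 j.2).2
      simp only [hs, Finset.coe_filter, Finset.mem_univ, true_and, Set.mem_ofPred_eq]
      exact fun x hx => h.mem_of_mem_support hp hk (hi hx) (hj hx)
    have htree : (T.induce (s : Set ι)).IsTree := ⟨hconn, h.isTree.isAcyclic.induce _⟩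
    have := htree.card_edgeFinset
    have h2 : Fintype.card (s : Set ι) = s.card := by simp
    omega

/-- A multiset of finite sets is determined by the numbers of its elements that contain a given
set. -/
theorem multiset_eq_of_countP_subset_eq {V : Type*} [Finite V] {M N : Multiset (Finset V)}
    (h : ∀ S : Finset V, ∀ [DecidablePred (S ⊆ ·)], M.countP (S ⊆ ·) = N.countP (S ⊆ ·)) :
    M = N := by
  classical
  have := Fintype.ofFinite V
  have key : ∀ (K : Multiset (Finset V)) (S : Finset V),
      K.countP (S ⊆ ·) = K.count S + ∑ S' ∈ Finset.univ.filter (S ⊂ ·), K.count S' := by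
    intro K S
    induction K using Multiset.induction with
    | empty => simp
    | cons a K ih =>
      simp only [Multiset.countP_cons, Multiset.count_cons, Finset.sum_add_distrib, ih,
        Finset.sum_ite_eq', Finset.mem_filter, Finset.mem_univ, true_and]
      by_cases h1 : S = a
      · simp [h1]; omega
      · have : S ⊆ a ↔ S ⊂ a := ⟨fun h => h.ssubset_of_ne h1, fun h => h.subset⟩
        simp [h1, this]; omega
  ext S
  -- Downward induction on S: by `key`, the count at S is the superset count minus the counts at
  -- strictly larger sets.
  induction hn : Fintype.card V - S.card using Nat.strong_induction_on generalizing S with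
  | _ n ih =>
    have hM := key M S
    have hN := key N S
    have : ∑ S' ∈ Finset.univ.filter (S ⊂ ·), M.count S' =
        ∑ S' ∈ Finset.univ.filter (S ⊂ ·), N.count S' := by
      refine Finset.sum_congr rfl fun S' hS' => ih _ ?_ S' rfl
      have h1 := Finset.card_lt_card (Finset.mem_filter.1 hS').2
      have h2 := Finset.card_le_univ S'
      omega
    have := h S
    omega

theorem IsJoinTree.treeIntersections_eq {V ι : Type*} [Finite V] [Fintype ι] {B : ι → Finset V}
    {T T' : SimpleGraph ι} (h : IsJoinTree B T) (h' : IsJoinTree B T') :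
    treeIntersections B T = treeIntersections B T' := by
  classical
  refine multiset_eq_of_countP_subset_eq fun S _ => ?_
  have := (h.card_filter_subset S).trans (h'.card_filter_subset S).symm
  convert this

theorem IsJoinTree.comap {V ι κ : Type*} {B : ι → Finset V} {T : SimpleGraph ι}
    (h : IsJoinTree B T) (e : κ ≃ ι) : IsJoinTree (B ∘ e) (T.comap e) := by
  refine ⟨(Iso.comap e T).isTree_iff.2 h.isTree, fun i j x hi hj => ?_⟩
  obtain ⟨p, hp⟩ := h.exists_walk _ _ x hi hj
  refine ⟨(p.map (Iso.comap e T).symm.toHom).copy (by simp) (by simp), fun k hk => ?_⟩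
  simp only [Walk.support_copy, Walk.support_map, List.mem_map] at hk
  obtain ⟨a, ha, rfl⟩ := hk
  simpa using hp a ha

theorem treeIntersections_comap {V ι κ : Type*} [Fintype ι] [Fintype κ] (B : ι → Finset V)
    (T : SimpleGraph ι) (e : κ ≃ ι) :
    treeIntersections (B ∘ e) (T.comap e) = treeIntersections B T := by
  classical
  have : T.edgeFinset = (T.comap e).edgeFinset.map e.toEmbedding.sym2Map := by
    ext s
    simp only [Finset.mem_map, mem_edgeFinset]
    constructor
    · induction s with | _ i j =>
      exact fun h => ⟨s(e.symm i, e.symm j), by simpa using h, by simp⟩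
    · rintro ⟨s, hs, rfl⟩
      induction s with | _ i j =>
      exact hs
  rw [treeIntersections, treeIntersections, this, Finset.map_val, Multiset.map_map]
  refine Multiset.map_congr rfl fun s _ => ?_
  induction s with | _ i j => rfl

/-! ### Maximal cliques and minimal separators -/

theorem IsCliqueEnumeration.isMaxClique {V ι : Type*} {G : SimpleGraph V} {B : ι → Finset V}
    (h : IsCliqueEnumeration G B) (i : ι) : IsMaxClique G (B i) := by
  refine ⟨h.isClique i, fun K hK hle => ?_⟩
  obtain ⟨j, hj⟩ := h.exists_subset K hK
  obtain rfl := h.eq_of_subset i j (by exact_mod_cast hle.trans hj)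
  exact hj

theorem IsCliqueEnumeration.exists_eq {V ι : Type*} {G : SimpleGraph V} {B : ι → Finset V}
    (h : IsCliqueEnumeration G B) {Q : Finset V} (hQ : IsMaxClique G Q) : ∃ i, B i = Q := by
  obtain ⟨i, hi⟩ := h.exists_subset Q hQ.1
  exact ⟨i, Finset.coe_injective ((hQ.2 (h.isClique i) hi).antisymm hi)⟩

/-- A clique enumeration, as a bijection onto the set of maximal cliques. -/
noncomputable def IsCliqueEnumeration.equiv {V ι : Type*} {G : SimpleGraph V} {B : ι → Finset V}
    (h : IsCliqueEnumeration G B) : ι ≃ {Q : Finset V // IsMaxClique G Q} :=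
  Equiv.ofBijective (fun i => ⟨B i, h.isMaxClique i⟩)
    ⟨fun i j hij => h.eq_of_subset i j (Subtype.ext_iff.1 hij).le,
      fun Q => (h.exists_eq Q.2).imp fun _ => Subtype.ext⟩

theorem IsCliqueEnumeration.comp_equiv_symm {V ι : Type*} {G : SimpleGraph V} {B : ι → Finset V}
    (h : IsCliqueEnumeration G B) : B ∘ h.equiv.symm = Subtype.val := by
  ext1 Q
  exact congrArg Subtype.val (h.equiv.apply_symm_apply Q)

/-- Deleting the edge ij splits the tree in two, and a vertex outside S occurs on one side only, so
no walk avoiding S changes side. Taking u in B i \ B j and v in B j \ B i, S separates them; it is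
minimal because each of its elements is adjacent to both. -/
theorem IsCliqueEnumeration.isMinimalVertexSeparator {V ι : Type*} {G : SimpleGraph V}
    {B : ι → Finset V} {T : SimpleGraph ι} (h : IsCliqueEnumeration G B) (hT : IsJoinTree B T)
    {i j : ι} (hij : T.Adj i j) : IsMinimalVertexSeparator G (edgeInter B s(i, j)) := by
  set S := edgeInter B s(i, j) with hS
  have hsame : ∀ x ∉ S, ∀ k l, x ∈ B k → x ∈ B l → (T.deleteEdges {s(i, j)}).Reachable k l := by
    intro x hx k l hk hl
    obtain ⟨p, hp⟩ := hT.exists_walk k l x hk hl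
    rw [reachable_deleteEdges_iff_exists_walk]
    refine ⟨p, fun he => hx (mem_edgeInter.2 ⟨hp i ?_, hp j ?_⟩)⟩
    · exact p.fst_mem_support_of_mem_edges he
    · exact p.snd_mem_support_of_mem_edges he
  have hbridge : ¬ (T.deleteEdges {s(i, j)}).Reachable i j :=
    isBridge_iff.1 (isAcyclic_iff_forall_adj_isBridge.1 hT.isTree.isAcyclic hij)
  have hexists : ∀ k l, T.Adj k l → ∃ u ∈ B k, u ∉ B l := by
    intro k l hkl
    by_contra! hcon
    exact hkl.ne (h.eq_of_subset k l hcon)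
  obtain ⟨u, hui, huj⟩ := hexists i j hij
  obtain ⟨v, hvj, hvi⟩ := hexists j i hij.symm
  have huS : u ∉ S := fun hu => huj (mem_edgeInter.1 hu).2
  have hvS : v ∉ S := fun hv => hvi (mem_edgeInter.1 hv).1
  -- Some B l contains both x and y, and it lies on the side of x.
  have hstep : ∀ x y, x ∉ S → G.Adj x y →
      (∃ k, x ∈ B k ∧ (T.deleteEdges {s(i, j)}).Reachable i k) →
      ∃ k, y ∈ B k ∧ (T.deleteEdges {s(i, j)}).Reachable i k := by
    rintro x y hx hxy ⟨k, hk, hr⟩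
    obtain ⟨l, hl⟩ := h.exists_subset {x, y} (by simpa [isClique_pair] using fun _ => hxy)
    exact ⟨l, hl (by simp), hr.trans (hsame x hx k l hk (hl (by simp)))⟩
  have hvside : ¬ ∃ k, v ∈ B k ∧ (T.deleteEdges {s(i, j)}).Reachable i k := by
    rintro ⟨k, hk, hr⟩
    exact hbridge (hr.trans (hsame v hvS k j hk hvj))
  have huside : ∃ k, u ∈ B k ∧ (T.deleteEdges {s(i, j)}).Reachable i k := ⟨i, hui, .refl _⟩
  refine ⟨u, v, ⟨?_, fun huv => hvside (hstep u v huS huv huside), huS, hvS, ?_⟩, ?_⟩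
  · rintro rfl
    exact huj hvj
  · rintro ⟨p⟩
    have hwalk : ∀ (a b : {x : V | x ∉ S}), (G.induce {x : V | x ∉ S}).Walk a b →
        (∃ k, a.1 ∈ B k ∧ (T.deleteEdges {s(i, j)}).Reachable i k) →
        ∃ k, b.1 ∈ B k ∧ (T.deleteEdges {s(i, j)}).Reachable i k := by
      intro a b q
      induction q with
      | nil => exact id
      | @cons a _ _ hadj _ ih => exact fun ha => ih (hstep _ _ a.2 hadj ha)
    exact hvside (hwalk _ _ p huside)
  · rintro S' hS' ⟨-, -, hu', hv', hnr⟩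
    obtain ⟨x, hxS, hxS'⟩ := Finset.exists_of_ssubset hS'
    obtain ⟨hxi, hxj⟩ := mem_edgeInter.1 hxS
    have hux : G.Adj u x := h.isClique i hui hxi (by rintro rfl; exact huS hxS)
    have hxv : G.Adj x v := h.isClique j hxj hvj (by rintro rfl; exact hvS hxS)
    refine hnr (Reachable.trans (v := ⟨x, hxS'⟩) (Adj.reachable ?_) (Adj.reachable ?_))
    · exact hux
    · exact hxv

/-! ### Laplacian characteristic polynomials under the graph operations -/

section Laplacian

open Matrix

@[simp]
theorem addUniversal_adj_none_none {V : Type*} (G : SimpleGraph V) :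
    ¬ (addUniversal G).Adj none none :=
  id

@[simp]
theorem addUniversal_adj_none_some {V : Type*} (G : SimpleGraph V) (v : V) :
    (addUniversal G).Adj none (some v) :=
  trivial

@[simp]
theorem addUniversal_adj_some_none {V : Type*} (G : SimpleGraph V) (v : V) :
    (addUniversal G).Adj (some v) none :=
  trivial

@[simp]
theorem addUniversal_adj_some_some {V : Type*} (G : SimpleGraph V) (v w : V) :
    (addUniversal G).Adj (some v) (some w) ↔ G.Adj v w :=
  Iff.rfl

theorem lapMatrix_apply {V : Type*} [Fintype V] [DecidableEq V] (G : SimpleGraph V)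
    [DecidableRel G.Adj] (v w : V) :
    G.lapMatrix ℝ v w = (if v = w then (G.degree v : ℝ) else 0) - if G.Adj v w then 1 else 0 := by
  simp [lapMatrix, degMatrix, adjMatrix_apply, Matrix.diagonal_apply]

theorem degree_addUniversal_none {V : Type*} [Fintype V] (G : SimpleGraph V)
    [DecidableRel (addUniversal G).Adj] : (addUniversal G).degree none = Fintype.card V := by
  classical
  have : (addUniversal G).neighborFinset none = Finset.univ.map Function.Embedding.some := by
    ext (_ | v) <;> simp 
  rw [← card_neighborFinset_eq_degree, this]
  simp

theorem degree_addUniversal_some {V : Type*} [Fintype V] (G : SimpleGraph V) [DecidableRel G.Adj]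
    [DecidableRel (addUniversal G).Adj] (v : V) :
    (addUniversal G).degree (some v) = G.degree v + 1 := by
  classical
  have : (addUniversal G).neighborFinset (some v) = (G.neighborFinset v).insertNone := by
    ext (_ | v) <;> simp 
  rw [← card_neighborFinset_eq_degree, this]
  simp

theorem degree_sum_inl {V W : Type*} [Fintype V] [Fintype W] (G : SimpleGraph V)
    (H : SimpleGraph W) [DecidableRel G.Adj] [DecidableRel (G.sum H).Adj] (v : V) :
    (G.sum H).degree (.inl v) = G.degree v := by
  have : (G.sum H).neighborFinset (.inl v) = (G.neighborFinset v).map .inl := by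
    ext (_ | v) <;> simp
  rw [← card_neighborFinset_eq_degree, this]
  simp

theorem degree_sum_inr {V W : Type*} [Fintype V] [Fintype W] (G : SimpleGraph V)
    (H : SimpleGraph W) [DecidableRel H.Adj] [DecidableRel (G.sum H).Adj] (w : W) :
    (G.sum H).degree (.inr w) = H.degree w := by
  have : (G.sum H).neighborFinset (.inr w) = (H.neighborFinset w).map .inr := by
    ext (_ | v) <;> simp
  rw [← card_neighborFinset_eq_degree, this]
  simp

/-- Bordering argument: the block A of the old vertices has all row sums X - 1, so one column
operation triangularises the bordered matrix. The factor X - 1 on the left is the determinant of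
that operation. -/
theorem charpoly_lapMatrix_addUniversal {V : Type*} [Fintype V] [DecidableEq V]
    (G : SimpleGraph V) [DecidableRel G.Adj] [DecidableRel (addUniversal G).Adj] :
    (X - 1) * ((addUniversal G).lapMatrix ℝ).charpoly =
      X * (X - C ((Fintype.card V : ℝ) + 1)) * (G.lapMatrix ℝ).charpoly.comp (X - 1) := by
  set n : ℝ := (Fintype.card V : ℝ)
  -- Old degrees rise by one, so the old block is the characteristic matrix of L + 1.
  set A : Matrix V V ℝ[X] := (G.lapMatrix ℝ - Matrix.scalar V (-1)).charmatrix with hA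
  set u : Matrix V PUnit.{1} ℝ[X] := .of fun _ _ => 1 with hu
  set r : Matrix PUnit.{1} PUnit.{1} ℝ[X] := .of fun _ _ => X - C n with hr
  have hdet : A.det = (G.lapMatrix ℝ).charpoly.comp (X - 1) := by
    have := Matrix.charpoly_sub_scalar (G.lapMatrix ℝ) (-1)
    rw [Matrix.charpoly] at this
    rw [hA, this]
    simp [sub_eq_add_neg]
  have hrow : ∀ v, ∑ w, A v w = X - 1 := by
    intro v
    have h1 : ∀ w, A v w = (if v = w then X - 1 - C (G.degree v : ℝ) else 0) +
        if G.Adj v w then 1 else 0 := by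
      intro w
      rw [hA, Matrix.charmatrix_apply, Matrix.sub_apply, lapMatrix_apply]
      by_cases hvw : v = w
      · subst hvw
        simp
        ring
      · by_cases hadj : G.Adj v w <;> simp [hvw, hadj]
    simp only [h1, Finset.sum_add_distrib, Finset.sum_ite_eq, Finset.mem_univ, if_true]
    rw [← degree_eq_sum_if_adj]
    simp
  have hblocks : ((addUniversal G).lapMatrix ℝ).charmatrix.submatrix
      (Equiv.optionEquivSumPUnit V).symm (Equiv.optionEquivSumPUnit V).symm =
      Matrix.fromBlocks A u uᵀ r := by
    ext1 (v | v) (w | w)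
    · simp only [Matrix.submatrix_apply, Equiv.optionEquivSumPUnit_symm_inl,
        Matrix.fromBlocks_apply₁₁, hA, Matrix.charmatrix_apply, lapMatrix_apply,
        degree_addUniversal_some, Matrix.sub_apply]
      by_cases hvw : v = w
      · subst hvw
        simp 
      · simp [hvw]
    · simp [lapMatrix_apply, hu]
    · simp [lapMatrix_apply, hu]
    · simp [lapMatrix_apply, degree_addUniversal_none, hr, n]
  -- The last column is multiplied by X - 1 and the sum of the other columns is subtracted. The
  -- corner becomes (X - n)(X - 1) - n = X(X - (n + 1)).
  have hmul : Matrix.fromBlocks A u uᵀ r *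
      Matrix.fromBlocks (1 : Matrix V V ℝ[X]) (-u) 0 (.of fun _ _ => X - 1) =
      Matrix.fromBlocks A 0 uᵀ (.of fun _ _ => X * (X - C (n + 1))) := by
    rw [Matrix.fromBlocks_multiply]
    congr 1
    · simp
    · ext1 v w
      simp [Matrix.mul_apply, hrow, hu]
    · ext1 v w
      simp [hu]
    · ext1 v w
      simp [Matrix.mul_apply, hu, hr, n]
      ring
  have := congrArg Matrix.det hmul
  rw [Matrix.det_mul, ← hblocks, Matrix.det_submatrix_equiv_self, Matrix.det_fromBlocks_zero₂₁,
    Matrix.det_fromBlocks_zero₁₂, hdet] at this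
  simp only [Matrix.det_one, Matrix.det_unique, one_mul, Matrix.of_apply] at this
  rw [Matrix.charpoly, mul_comm, this]
  ring

theorem charpoly_lapMatrix_sum {V W : Type*} [Fintype V] [DecidableEq V] [Fintype W]
    [DecidableEq W] (G : SimpleGraph V) (H : SimpleGraph W) [DecidableRel G.Adj]
    [DecidableRel H.Adj] [DecidableRel (G.sum H).Adj] :
    ((G.sum H).lapMatrix ℝ).charpoly = (G.lapMatrix ℝ).charpoly * (H.lapMatrix ℝ).charpoly := by
  have : (G.sum H).lapMatrix ℝ = Matrix.fromBlocks (G.lapMatrix ℝ) 0 0 (H.lapMatrix ℝ) := by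
    ext (v | v) (w | w) <;>
      simp [lapMatrix_apply, degree_sum_inl, degree_sum_inr]
  rw [this, Matrix.charpoly_fromBlocks_zero₁₂]

theorem charpoly_lapMatrix_iso {V W : Type*} [Fintype V] [DecidableEq V] [Fintype W]
    [DecidableEq W] {G : SimpleGraph V} {H : SimpleGraph W} [DecidableRel G.Adj]
    [DecidableRel H.Adj] (e : G ≃g H) :
    (H.lapMatrix ℝ).charpoly = (G.lapMatrix ℝ).charpoly := by
  rw [← Matrix.charpoly_reindex e.toEquiv]
  congr 1
  ext v w
  have h1 : G.Adj (e.symm v) (e.symm w) ↔ H.Adj v w := e.symm.map_adj_iff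
  have h2 : G.degree (e.symm v) = H.degree v := e.symm.degree_eq v
  simp only [Matrix.reindex_apply, Matrix.submatrix_apply, lapMatrix_apply]
  have h3 : e.symm v = e.symm w ↔ v = w := e.symm.injective.eq_iff
  change _ = (if e.symm v = e.symm w then (G.degree (e.symm v) : ℝ) else 0) -
    if G.Adj (e.symm v) (e.symm w) then 1 else 0
  simp only [h1, h2, h3]

end Laplacian

/-! ### Simplicial vertices, maximal cliques and join trees under the graph operations -/

theorem isSimplicial_iff {V : Type*} {G : SimpleGraph V} {v : V} :
    IsSimplicial G v ↔ ∀ a b, G.Adj v a → G.Adj v b → a ≠ b → G.Adj a b :=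
  ⟨fun h _ _ ha hb hab => h ha hb hab, fun h a ha b hb hab => h a b ha hb hab⟩

theorem isSimplicial_addUniversal_none {V : Type*} {G : SimpleGraph V} :
    IsSimplicial (addUniversal G) none ↔ G.IsClique Set.univ := by
  simp [isSimplicial_iff, Option.forall, Set.pairwise_univ, Pairwise, IsClique]

theorem isSimplicial_addUniversal_some {V : Type*} {G : SimpleGraph V} {v : V} :
    IsSimplicial (addUniversal G) (some v) ↔ IsSimplicial G v := by
  simp [isSimplicial_iff, Option.forall]

theorem isSimplicial_sum_inl {V W : Type*} {G : SimpleGraph V} {H : SimpleGraph W} {v : V} :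
    IsSimplicial (G.sum H) (.inl v) ↔ IsSimplicial G v := by
  simp [isSimplicial_iff]

theorem isSimplicial_sum_inr {V W : Type*} {G : SimpleGraph V} {H : SimpleGraph W} {w : W} :
    IsSimplicial (G.sum H) (.inr w) ↔ IsSimplicial H w := by
  simp [isSimplicial_iff]

theorem isSimplicial_iso {V W : Type*} {G : SimpleGraph V} {H : SimpleGraph W} (e : G ≃g H)
    {v : V} : IsSimplicial H (e v) ↔ IsSimplicial G v := by
  simp only [isSimplicial_iff, e.surjective.forall, e.map_adj_iff, ne_eq,
    e.injective.eq_iff]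

theorem IsCliqueEnumeration.addUniversal {V ι : Type*} {G : SimpleGraph V} {B : ι → Finset V}
    (h : IsCliqueEnumeration G B) :
    IsCliqueEnumeration (addUniversal G) (fun i => (B i).insertNone) := by
  refine ⟨fun i => ?_, fun K hK => ?_, fun i j hij => ?_⟩
  · rintro (_ | v) hv (_ | w) hw hvw
    · exact absurd rfl hvw
    · simp
    · simp
    · simp only [Finset.mem_coe, Finset.some_mem_insertNone] at hv hw
      exact h.isClique i hv hw (by simpa using hvw)
  · obtain ⟨i, hi⟩ := h.exists_subset (some ⁻¹' K) fun v hv w hw hvw =>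
      hK hv hw (by simpa using hvw)
    refine ⟨i, ?_⟩
    rintro (_ | v) hv
    · simp
    · simpa using hi hv
  · exact h.eq_of_subset i j fun v hv =>
      Finset.some_mem_insertNone.1 (hij (Finset.some_mem_insertNone.2 hv))

/-- Nonemptiness matters: on an empty side the maximal clique would be ∅, which lies in every clique
of the other side. -/
theorem IsCliqueEnumeration.sum {V W ι κ : Type*} {G : SimpleGraph V} {H : SimpleGraph W}
    {B : ι → Finset V} {C : κ → Finset W} [Nonempty V] [Nonempty W]
    (hB : IsCliqueEnumeration G B) (hC : IsCliqueEnumeration H C) :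
    IsCliqueEnumeration (G.sum H)
      (Sum.elim (fun i => (B i).map .inl) (fun j => (C j).map .inr)) := by
  have hBne : ∀ i, (B i).Nonempty := by
    intro i
    obtain ⟨v⟩ := ‹Nonempty V›
    obtain ⟨j, hj⟩ := hB.exists_subset {v} (by simp)
    by_contra hi
    rw [Finset.not_nonempty_iff_eq_empty] at hi
    obtain rfl := hB.eq_of_subset i j (by simp [hi])
    simp [hi] at hj
  have hCne : ∀ i, (C i).Nonempty := by
    intro i
    obtain ⟨v⟩ := ‹Nonempty W›
    obtain ⟨j, hj⟩ := hC.exists_subset {v} (by simp)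
    by_contra hi
    rw [Finset.not_nonempty_iff_eq_empty] at hi
    obtain rfl := hC.eq_of_subset i j (by simp [hi])
    simp [hi] at hj
  refine ⟨?_, fun K hK => ?_, ?_⟩
  · rintro (i | j) x hx y hy hxy
    · simp only [Sum.elim_inl, Finset.coe_map, Set.mem_image, Finset.mem_coe] at hx hy
      obtain ⟨x, hx, rfl⟩ := hx
      obtain ⟨y, hy, rfl⟩ := hy
      exact hB.isClique i hx hy (by rintro rfl; exact hxy rfl)
    · simp only [Sum.elim_inr, Finset.coe_map, Set.mem_image, Finset.mem_coe] at hx hy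
      obtain ⟨x, hx, rfl⟩ := hx
      obtain ⟨y, hy, rfl⟩ := hy
      exact hC.isClique j hx hy (by rintro rfl; exact hxy rfl)
  · obtain ⟨i, hi⟩ := hB.exists_subset (Sum.inl ⁻¹' K) fun v hv w hw hvw => by
      simpa using hK hv hw (by simpa using hvw)
    obtain ⟨j, hj⟩ := hC.exists_subset (Sum.inr ⁻¹' K) fun v hv w hw hvw => by
      simpa using hK hv hw (by simpa using hvw)
    by_cases hl : ∃ v, Sum.inl v ∈ K
    · obtain ⟨v, hv⟩ := hl
      refine ⟨.inl i, ?_⟩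
      rintro (w | w) hw
      · simpa using hi hw
      · simpa using hK hv hw (by simp)
    · push Not at hl
      refine ⟨.inr j, ?_⟩
      rintro (w | w) hw
      · exact absurd hw (hl w)
      · simpa using hj hw
  · rintro (i | i) (j | j) hij
    · exact congrArg _ (hB.eq_of_subset i j (by simpa using hij))
    · obtain ⟨v, hv⟩ := hBne i
      have := @hij (.inl v) (by simpa using hv)
      simp at this
    · obtain ⟨v, hv⟩ := hCne i
      have := @hij (.inr v) (by simpa using hv)
      simp at this
    · exact congrArg _ (hC.eq_of_subset i j (by simpa using hij))

theorem IsCliqueEnumeration.iso {V W ι : Type*} {G : SimpleGraph V} {H : SimpleGraph W}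
    {B : ι → Finset V} (h : IsCliqueEnumeration G B) (e : G ≃g H) :
    IsCliqueEnumeration H (fun i => (B i).map e.toEquiv.toEmbedding) := by
  refine ⟨fun i => ?_, fun K hK => ?_, fun i j hij => ?_⟩
  · intro x hx y hy hxy
    simp only [Finset.coe_map, Set.mem_image, Finset.mem_coe] at hx hy
    obtain ⟨x, hx, rfl⟩ := hx
    obtain ⟨y, hy, rfl⟩ := hy
    exact e.map_adj_iff.2 (h.isClique i hx hy (by rintro rfl; exact hxy rfl))
  · obtain ⟨i, hi⟩ := h.exists_subset (e ⁻¹' K) fun v hv w hw hvw =>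
      e.map_adj_iff.1 (hK hv hw (e.injective.ne hvw))
    refine ⟨i, fun x hx => ?_⟩
    obtain ⟨x, rfl⟩ := e.surjective x
    exact Finset.mem_coe.2 (Finset.mem_map.2 ⟨x, hi hx, rfl⟩)
  · exact h.eq_of_subset i j (by simpa using hij)

theorem IsJoinTree.insertNone {V ι : Type*} {B : ι → Finset V} {T : SimpleGraph ι}
    (h : IsJoinTree B T) : IsJoinTree (fun i => (B i).insertNone) T := by
  refine ⟨h.isTree, ?_⟩
  rintro i j (_ | x) hi hj
  · obtain ⟨p⟩ := h.isTree.connected i j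
    exact ⟨p, by simp⟩
  · simpa using h.exists_walk i j x (by simpa using hi) (by simpa using hj)

theorem IsJoinTree.map {V W ι : Type*} {B : ι → Finset V} {T : SimpleGraph ι}
    (h : IsJoinTree B T) (f : V ↪ W) : IsJoinTree (fun i => (B i).map f) T := by
  refine ⟨h.isTree, fun i j x hi hj => ?_⟩
  obtain ⟨x, hx, rfl⟩ := Finset.mem_map.1 hi
  simpa using h.exists_walk i j x hx (by simpa using hj)

theorem treeIntersections_congr {V W ι : Type*} [Fintype ι] {B : ι → Finset V}
    {C : ι → Finset W} (T : SimpleGraph ι) (f : Finset V → Finset W)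
    (h : ∀ i j, f (edgeInter B s(i, j)) = edgeInter C s(i, j)) :
    treeIntersections C T = (treeIntersections B T).map f := by
  rw [treeIntersections, treeIntersections, Multiset.map_map]
  refine Multiset.map_congr rfl fun s _ => ?_
  induction s with | _ i j => exact (h i j).symm

open Classical in
theorem edgeFinset_sum_sup_edge {ι κ : Type*} [Fintype ι] [Fintype κ] (T : SimpleGraph ι)
    (U : SimpleGraph κ) (a : ι) (b : κ) :
    (T.sum U ⊔ edge (.inl a) (.inr b)).edgeFinset.val =
      s(.inl a, .inr b) ::ₘ
        (T.edgeFinset.val.map (Sym2.map .inl) + U.edgeFinset.val.map (Sym2.map .inr)) := by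
  have hdisj : Disjoint (T.edgeFinset.map (Function.Embedding.inl (β := κ)).sym2Map)
      (U.edgeFinset.map (Function.Embedding.inr (α := ι)).sym2Map) := by
    rw [Finset.disjoint_left]
    rintro s hs hs'
    obtain ⟨s, -, rfl⟩ := Finset.mem_map.1 hs
    obtain ⟨t, -, ht⟩ := Finset.mem_map.1 hs'
    induction s with | _ i j =>
    induction t with | _ k l =>
    simp at ht
  have hnot : s(.inl a, .inr b) ∉ (T.edgeFinset.map (Function.Embedding.inl (β := κ)).sym2Map).disjUnion
      (U.edgeFinset.map (Function.Embedding.inr (α := ι)).sym2Map) hdisj := by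
    rw [Finset.mem_disjUnion]
    rintro (hs | hs)
    · obtain ⟨s, -, hs⟩ := Finset.mem_map.1 hs
      induction s with | _ i j => simp at hs
    · obtain ⟨s, -, hs⟩ := Finset.mem_map.1 hs
      induction s with | _ i j => simp at hs
  have : (T.sum U ⊔ edge (.inl a) (.inr b)).edgeFinset = Finset.cons _ _ hnot := by
    ext s
    rw [Finset.mem_cons, Finset.mem_disjUnion, Finset.mem_map, Finset.mem_map]
    constructor
    · induction s with | _ i j =>
      rcases i with i | i <;> rcases j with j | j <;> intro h <;>
        simp at h
      · exact .inr (.inl ⟨s(i, j), by simpa using h, rfl⟩)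
      · simp [h]
      · simp [h]
      · exact .inr (.inr ⟨s(i, j), by simpa using h, rfl⟩)
    · rintro (rfl | ⟨s, hs, rfl⟩ | ⟨s, hs, rfl⟩)
      · simp
      · induction s with | _ i j => simpa using mem_edgeFinset.1 hs
      · induction s with | _ i j => simpa using mem_edgeFinset.1 hs
  rw [this]
  rfl

/-- No element belongs to sets on both sides, so the linking edge may have any ends a and b. -/
theorem IsJoinTree.sum {V W ι κ : Type*} [Fintype ι] [Fintype κ] {B : ι → Finset V}
    {C : κ → Finset W} {T : SimpleGraph ι} {U : SimpleGraph κ} (hT : IsJoinTree B T)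
    (hU : IsJoinTree C U) (a : ι) (b : κ) :
    IsJoinTree (Sum.elim (fun i => (B i).map .inl) (fun j => (C j).map .inr))
      (T.sum U ⊔ edge (.inl a) (.inr b)) := by
  classical
  refine ⟨isTree_iff_connected_and_card.2 ⟨hT.isTree.connected.sum_sup_edge hU.isTree.connected,
    ?_⟩, ?_⟩
  · have h1 := congrArg Multiset.card (edgeFinset_sum_sup_edge T U a b)
    have h2 := hT.isTree.card_edgeFinset
    have h3 := hU.isTree.card_edgeFinset
    simp only [Multiset.card_cons, Multiset.card_add, Multiset.card_map, Finset.card_val] at h1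
    rw [Nat.card_eq_fintype_card, ← edgeFinset_card, Nat.card_eq_fintype_card, Fintype.card_sum]
    convert (by omega : (T.sum U ⊔ edge (.inl a) (.inr b)).edgeFinset.card + 1 =
      Fintype.card ι + Fintype.card κ)
  · rintro (i | i) (j | j) x hi hj <;>
      simp only [Sum.elim_inl, Sum.elim_inr, Finset.mem_map] at hi hj
    · obtain ⟨x, hx, rfl⟩ := hi
      obtain ⟨p, hp⟩ := hT.exists_walk i j x hx (by simpa using hj)
      refine ⟨p.map ((Hom.ofLE le_sup_left).comp Embedding.sumInl.toHom), fun k hk => ?_⟩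
      obtain ⟨l, hl, rfl⟩ := List.mem_map.1 ((Walk.support_map _ p) ▸ hk)
      simpa using hp l hl
    · obtain ⟨x, -, rfl⟩ := hi
      simp at hj
    · obtain ⟨x, -, rfl⟩ := hi
      simp at hj
    · obtain ⟨x, hx, rfl⟩ := hi
      obtain ⟨p, hp⟩ := hU.exists_walk i j x hx (by simpa using hj)
      refine ⟨p.map ((Hom.ofLE le_sup_left).comp Embedding.sumInr.toHom), fun k hk => ?_⟩
      obtain ⟨l, hl, rfl⟩ := List.mem_map.1 ((Walk.support_map _ p) ▸ hk)
      simpa using hp l hl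

theorem treeIntersections_sum {V W ι κ : Type*} [Fintype ι] [Fintype κ] (B : ι → Finset V)
    (C : κ → Finset W) (T : SimpleGraph ι) (U : SimpleGraph κ) (a : ι) (b : κ) :
    treeIntersections (Sum.elim (fun i => (B i).map .inl) (fun j => (C j).map .inr))
        (T.sum U ⊔ edge (.inl a) (.inr b)) =
      ∅ ::ₘ ((treeIntersections B T).map (Finset.map .inl) +
        (treeIntersections C U).map (Finset.map .inr)) := by
  classical
  have h := edgeFinset_sum_sup_edge T U a b
  rw [treeIntersections, treeIntersections, treeIntersections, Multiset.map_map, Multiset.map_map]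
  have h' := congrArg (Multiset.map (edgeInter (Sum.elim (fun i => (B i).map Function.Embedding.inl)
    (fun j => (C j).map Function.Embedding.inr)))) h
  refine Eq.trans (by congr!) (h'.trans ?_)
  rw [Multiset.map_cons, Multiset.map_add, Multiset.map_map, Multiset.map_map]
  congr 1
  · ext x
    rw [mem_edgeInter]
    rcases x with x | x <;> simp
  · congr 1
    · refine Multiset.map_congr (by congr!) fun s _ => ?_
      induction s with | _ i j =>
      ext x
      simp only [Function.comp_apply, Sym2.map_mk, mem_edgeInter]
      rcases x with x | x <;> simp [mem_edgeInter]
    · refine Multiset.map_congr (by congr!) fun s _ => ?_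
      induction s with | _ i j =>
      ext x
      simp only [Function.comp_apply, Sym2.map_mk, mem_edgeInter]
      rcases x with x | x <;> simp [mem_edgeInter]

/-! ### The predicted spectrum under the graph operations -/

open Classical in
/-- The multiset of the nonzero Laplacian eigenvalues of a connected quasi-threshold graph, read
off an enumeration of its maximal cliques and a join tree. -/
noncomputable def cliqueTreeSpectrum {V ι : Type*} [Fintype V] [Fintype ι] (G : SimpleGraph V)
    (B : ι → Finset V) (T : SimpleGraph ι) : Multiset ℝ :=
  (nonSimplicial G).val.map (fun v => (G.degree v : ℝ) + 1)
    + ∑ i, Multiset.replicate ((simplicialIn G (B i)).card - 1) ((B i).card : ℝ)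
    + (treeIntersections B T).map (fun S => (S.card : ℝ))

theorem sum_map_multiset {ι α β : Type*} (s : Finset ι) (f : α → β) (g : ι → Multiset α) :
    (∑ i ∈ s, g i).map f = ∑ i ∈ s, (g i).map f :=
  map_sum (Multiset.mapAddMonoidHom f) g s

theorem treeIntersections_insertNone {V ι : Type*} [Fintype ι] (B : ι → Finset V)
    (T : SimpleGraph ι) :
    treeIntersections (fun i => (B i).insertNone) T =
      (treeIntersections B T).map (fun S => S.insertNone) := by
  refine treeIntersections_congr T _ fun i j => ?_
  ext (_ | x) <;> simp [mem_edgeInter]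

/-- Here the new vertex is simplicial, so n + 1 arises as one more repetition of the size of the
only maximal clique. -/
theorem cliqueTreeSpectrum_addUniversal_of_isClique {V ι : Type*} [Fintype V] [Nonempty V]
    [Fintype ι] {G : SimpleGraph V} {B : ι → Finset V} (h : IsCliqueEnumeration G B)
    (T : SimpleGraph ι) (hG : G.IsClique Set.univ) :
    cliqueTreeSpectrum (addUniversal G) (fun i => (B i).insertNone) T =
      ((Fintype.card V : ℝ) + 1) ::ₘ (cliqueTreeSpectrum G B T).map (· + 1) := by
  classical
  obtain ⟨i, hi⟩ := h.exists_subset _ hG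
  have hBi : B i = Finset.univ := by
    ext x
    simpa using hi (Set.mem_univ x)
  have hall : ∀ j, j = i := fun j => h.eq_of_subset j i (by simp [hBi])
  have huniv : (Finset.univ : Finset ι) = {i} := by
    ext j
    simpa using hall j
  have hsimp : ∀ v, IsSimplicial G v := fun v =>
    isSimplicial_iff.2 fun a b _ _ hab => hG (Set.mem_univ a) (Set.mem_univ b) hab
  have hsimp' : ∀ v, IsSimplicial (addUniversal G) v := by
    rintro (_ | v)
    · exact isSimplicial_addUniversal_none.2 hG
    · exact isSimplicial_addUniversal_some.2 (hsimp v)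
  have hT : T.edgeFinset = ∅ := by
    ext s
    induction s with | _ j k =>
    simp [hall j, hall k]
  have hn : 0 < Fintype.card V := Fintype.card_pos
  have hcard : (Finset.insertNone (Finset.univ : Finset V)).card = Fintype.card V + 1 := by simp
  obtain ⟨m, hm⟩ := Nat.exists_eq_succ_of_ne_zero hn.ne'
  simp [cliqueTreeSpectrum, treeIntersections, hT, nonSimplicial, simplicialIn, hsimp, hsimp',
    huniv, hBi, hm, Multiset.replicate_succ]

/-- Here the new vertex is not simplicial: it gives its degree n plus one, and the simplicial counts
do not change. -/
theorem cliqueTreeSpectrum_addUniversal_of_not_isClique {V ι : Type*} [Fintype V]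
    [Fintype ι] {G : SimpleGraph V} (B : ι → Finset V)
    (T : SimpleGraph ι) (hG : ¬ G.IsClique Set.univ) :
    cliqueTreeSpectrum (addUniversal G) (fun i => (B i).insertNone) T =
      ((Fintype.card V : ℝ) + 1) ::ₘ (cliqueTreeSpectrum G B T).map (· + 1) := by
  classical
  have h1 : nonSimplicial (addUniversal G) =
      Finset.cons none ((nonSimplicial G).map .some) (by simp) := by
    ext (_ | v)
    · simp [nonSimplicial, isSimplicial_addUniversal_none, hG]
    · simp [nonSimplicial, isSimplicial_addUniversal_some]
  have h2 : ∀ Q : Finset V, (simplicialIn (addUniversal G) Q.insertNone).card =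
      (simplicialIn G Q).card := by
    intro Q
    have : simplicialIn (addUniversal G) Q.insertNone = (simplicialIn G Q).map .some := by
      ext (_ | v)
      · simp [simplicialIn, isSimplicial_addUniversal_none, hG]
      · simp [simplicialIn, isSimplicial_addUniversal_some]
    rw [this, Finset.card_map]
  simp only [cliqueTreeSpectrum, h1, h2, treeIntersections_insertNone, Finset.cons_val,
    Multiset.map_cons, degree_addUniversal_none, degree_addUniversal_some, Finset.map_val,
    Multiset.map_map, Multiset.map_add, sum_map_multiset, Multiset.map_replicate,
    Finset.card_insertNone, Multiset.cons_add, Function.comp_def, Function.Embedding.some_apply,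
    Nat.cast_add, Nat.cast_one]

theorem cliqueTreeSpectrum_addUniversal {V ι : Type*} [Fintype V] [Nonempty V]
    [Fintype ι] {G : SimpleGraph V} {B : ι → Finset V} (h : IsCliqueEnumeration G B)
    (T : SimpleGraph ι) :
    cliqueTreeSpectrum (addUniversal G) (fun i => (B i).insertNone) T =
      ((Fintype.card V : ℝ) + 1) ::ₘ (cliqueTreeSpectrum G B T).map (· + 1) := by
  by_cases hG : G.IsClique Set.univ
  · exact cliqueTreeSpectrum_addUniversal_of_isClique h T hG
  · exact cliqueTreeSpectrum_addUniversal_of_not_isClique B T hG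

/-- The extra 0 is the size of the empty intersection on the linking edge. -/
theorem cliqueTreeSpectrum_sum {V W ι κ : Type*} [Fintype V] [Fintype W] [Fintype ι] [Fintype κ]
    (G : SimpleGraph V) (H : SimpleGraph W) (B : ι → Finset V) (C : κ → Finset W)
    (T : SimpleGraph ι) (U : SimpleGraph κ) (a : ι) (b : κ) :
    cliqueTreeSpectrum (G.sum H) (Sum.elim (fun i => (B i).map .inl) (fun j => (C j).map .inr))
        (T.sum U ⊔ edge (.inl a) (.inr b)) =
      0 ::ₘ (cliqueTreeSpectrum G B T + cliqueTreeSpectrum H C U) := by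
  classical
  have h1 : nonSimplicial (G.sum H) = (nonSimplicial G).disjSum (nonSimplicial H) := by
    ext (v | v) <;> simp [nonSimplicial, isSimplicial_sum_inl, isSimplicial_sum_inr]
  have h2 : ∀ Q : Finset V, (simplicialIn (G.sum H) (Q.map .inl)).card =
      (simplicialIn G Q).card := by
    intro Q
    have : simplicialIn (G.sum H) (Q.map .inl) = (simplicialIn G Q).map .inl := by
      ext (v | v) <;> simp [simplicialIn, isSimplicial_sum_inl]
    rw [this, Finset.card_map]
  have h3 : ∀ Q : Finset W, (simplicialIn (G.sum H) (Q.map .inr)).card =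
      (simplicialIn H Q).card := by
    intro Q
    have : simplicialIn (G.sum H) (Q.map .inr) = (simplicialIn H Q).map .inr := by
      ext (v | v) <;> simp [simplicialIn, isSimplicial_sum_inr]
    rw [this, Finset.card_map]
  simp only [cliqueTreeSpectrum, h1, h2, h3, treeIntersections_sum, Finset.val_disjSum,
    Multiset.disjSum, Multiset.map_cons, Multiset.map_add, Multiset.map_map, Function.comp_def,
    degree_sum_inl, degree_sum_inr, Fintype.sum_sum_type, Sum.elim_inl, Sum.elim_inr,
    Finset.card_map, Finset.card_empty, Nat.cast_zero]
  rw [Multiset.add_cons]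
  congr 1
  abel

theorem cliqueTreeSpectrum_iso {V W ι : Type*} [Fintype V] [Fintype W] [Fintype ι]
    {G : SimpleGraph V} {H : SimpleGraph W} (e : G ≃g H) (B : ι → Finset V) (T : SimpleGraph ι) :
    cliqueTreeSpectrum H (fun i => (B i).map e.toEquiv.toEmbedding) T =
      cliqueTreeSpectrum G B T := by
  classical
  have h1 : nonSimplicial H = (nonSimplicial G).map e.toEquiv.toEmbedding := by
    ext w
    obtain ⟨v, rfl⟩ := e.surjective w
    have : e v ∈ (nonSimplicial G).map e.toEquiv.toEmbedding ↔ v ∈ nonSimplicial G :=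
      Finset.mem_map' e.toEquiv.toEmbedding
    rw [this]
    simp [nonSimplicial, isSimplicial_iso]
  have h2 : ∀ Q : Finset V, (simplicialIn H (Q.map e.toEquiv.toEmbedding)).card =
      (simplicialIn G Q).card := by
    intro Q
    have : simplicialIn H (Q.map e.toEquiv.toEmbedding) =
        (simplicialIn G Q).map e.toEquiv.toEmbedding := by
      rw [simplicialIn, simplicialIn, Finset.filter_map]
      congr 1
      exact Finset.filter_congr fun v _ => isSimplicial_iso e
    rw [this, Finset.card_map]
  have h3 : treeIntersections (fun i => (B i).map e.toEquiv.toEmbedding) T =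
      (treeIntersections B T).map (Finset.map e.toEquiv.toEmbedding) := by
    refine treeIntersections_congr T _ fun i j => ?_
    simp [edgeInter, Finset.map_inter]
  have h4 : ∀ v, H.degree (e v) = G.degree v := fun v => e.degree_eq v
  simp only [cliqueTreeSpectrum, h1, h2, h3, Finset.map_val, Multiset.map_map, Function.comp_def,
    Finset.card_map]
  congr! 4 with v
  exact congrArg Nat.cast (h4 v)

/-! ### The induction and the regrouping over separators -/

/-- A quasi-threshold graph has an enumeration of its maximal cliques and a join tree that
determine the characteristic polynomial of its Laplacian matrix. -/
theorem IsQuasiThreshold.exists_isJoinTree {V : Type*} {G : SimpleGraph V}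
    (hG : IsQuasiThreshold G) : Nonempty V ∧ ∀ [Fintype V],
      ∃ (ι : Type) (_ : Fintype ι) (B : ι → Finset V) (T : SimpleGraph ι),
        IsCliqueEnumeration G B ∧ IsJoinTree B T ∧
          ∀ [DecidableEq V] [DecidableRel G.Adj], (G.lapMatrix ℝ).charpoly =
            ((0 ::ₘ cliqueTreeSpectrum G B T).map fun r => X - C r).prod := by
  -- Finiteness is not part of the inductive class, so it is quantified inside the claim and
  -- recovered for the smaller graphs by injections. Nonemptiness is carried along for the universal
  -- and union steps.
  induction hG with
  | isolated =>
    refine ⟨inferInstance, fun {_} => ?_⟩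
    refine ⟨Unit, inferInstance, fun _ => Finset.univ, ⊥, ⟨?_, ?_, ?_⟩, ⟨?_, ?_⟩, ?_⟩
    · intro i x _ y _ hxy
      exact absurd (Subsingleton.elim x y) hxy
    · simp
    · simp
    · exact .of_subsingleton
    · intro i j x _ _
      exact ⟨.nil, by simp⟩
    · intro _ _
      have hspec : cliqueTreeSpectrum (⊥ : SimpleGraph PUnit) (fun _ : Unit => Finset.univ) ⊥ = 0 := by
        simp [cliqueTreeSpectrum, nonSimplicial, simplicialIn, isSimplicial_iff, treeIntersections]
      rw [hspec]
      simp [Matrix.charpoly, Matrix.det_unique, lapMatrix_apply]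
  | @universal V G _ ih =>
    obtain ⟨hne, ih⟩ := ih
    refine ⟨inferInstance, fun {inst} => ?_⟩
    have : Fintype V := Fintype.ofInjective some (Option.some_injective V)
    obtain rfl : inst = instFintypeOption := Subsingleton.elim _ _
    obtain ⟨ι, _, B, T, hB, hT, hchar⟩ := ih
    refine ⟨ι, inferInstance, _, T, hB.addUniversal, hT.insertNone, fun {hdec _} => ?_⟩
    classical
    obtain rfl : hdec = Option.instDecidableEq := Subsingleton.elim _ _
    have h := charpoly_lapMatrix_addUniversal G
    -- The root 0 of the old polynomial becomes 1 under the shift; its factor X - 1 is the one to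
    -- cancel.
    have hX : (X - 1 : ℝ[X]) ≠ 0 := by simpa using X_sub_C_ne_zero (1 : ℝ)
    refine mul_left_cancel₀ hX ?_
    rw [h, hchar, multiset_prod_comp, cliqueTreeSpectrum_addUniversal hB]
    simp only [Multiset.map_cons, Multiset.prod_cons, Multiset.map_map, Function.comp_def]
    have : ∀ r : ℝ, (X - C r).comp (X - 1) = X - C (r + 1) := by
      intro r
      simp
      ring
    simp only [this]
    simp
    ring
  | @disjointUnion V W G H _ _ ihG ihH =>
    obtain ⟨hV, ihG⟩ := ihG
    obtain ⟨hW, ihH⟩ := ihH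
    refine ⟨inferInstance, fun {inst} => ?_⟩
    have : Fintype V := Fintype.ofInjective _ (Sum.inl_injective (α := V) (β := W))
    have : Fintype W := Fintype.ofInjective _ (Sum.inr_injective (α := V) (β := W))
    obtain rfl : inst = instFintypeSum V W := Subsingleton.elim _ _
    obtain ⟨ι, _, B, T, hB, hT, hcharG⟩ := ihG
    obtain ⟨κ, _, D, U, hD, hU, hcharH⟩ := ihH
    obtain ⟨a⟩ := hT.isTree.connected.nonempty
    obtain ⟨b⟩ := hU.isTree.connected.nonempty
    refine ⟨ι ⊕ κ, inferInstance, _, _, hB.sum hD, hT.sum hU a b, fun {hdec _} => ?_⟩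
    classical
    obtain rfl : hdec = instDecidableEqSum := Subsingleton.elim _ _
    rw [charpoly_lapMatrix_sum, hcharG, hcharH, cliqueTreeSpectrum_sum]
    simp only [Multiset.map_cons, Multiset.prod_cons, Multiset.map_add, Multiset.prod_add]
    ring
  | @iso V W G H e _ ih =>
    obtain ⟨e⟩ := e
    obtain ⟨hV, ih⟩ := ih
    refine ⟨⟨e hV.some⟩, fun {_} => ?_⟩
    have : Fintype V := Fintype.ofInjective _ e.injective
    obtain ⟨ι, _, B, T, hB, hT, hchar⟩ := ih
    refine ⟨ι, inferInstance, _, T, hB.iso e, hT.map _, fun {_ _} => ?_⟩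
    classical
    rw [charpoly_lapMatrix_iso e, hchar, cliqueTreeSpectrum_iso]

open Classical in
theorem cliqueTreeSpectrum_comap {V ι κ : Type*} [Fintype V] [Fintype ι] [Fintype κ]
    (G : SimpleGraph V) (B : ι → Finset V) (T : SimpleGraph ι) (e : κ ≃ ι) :
    cliqueTreeSpectrum G (B ∘ e) (T.comap e) = cliqueTreeSpectrum G B T := by
  rw [cliqueTreeSpectrum, cliqueTreeSpectrum, treeIntersections_comap]
  congr 2
  exact Equiv.sum_comp e fun i =>
    Multiset.replicate ((simplicialIn G (B i)).card - 1) ((B i).card : ℝ)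

-- Only one inclusion is needed: a minimal separator that is not an edge intersection would have
-- multiplicity 0 and add nothing.
open Classical in
theorem cliqueTreeSpectrum_val {V : Type*} [Fintype V] {G : SimpleGraph V}
    {T : SimpleGraph {Q : Finset V // IsMaxClique G Q}}
    (hT : ∀ S ∈ edgeIntersections G T, IsMinimalVertexSeparator G S) :
    cliqueTreeSpectrum G Subtype.val T =
      (nonSimplicial G).val.map (fun v => (G.degree v : ℝ) + 1)
        + ∑ Q ∈ maxCliques G, Multiset.replicate ((simplicialIn G Q).card - 1) (Q.card : ℝ)
        + ∑ S ∈ minimalVertexSeparators G,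
            Multiset.replicate (multiplicity G T S) (S.card : ℝ) := by
  rw [cliqueTreeSpectrum]
  congr 1
  · congr 1
    exact (Finset.sum_subtype (maxCliques G) (p := IsMaxClique G) (by simp [maxCliques])
      (fun Q => Multiset.replicate ((simplicialIn G Q).card - 1) (Q.card : ℝ))).symm
  · have hsub : (edgeIntersections G T).toFinset ⊆ minimalVertexSeparators G := fun S hS =>
      Finset.mem_filter.2 ⟨Finset.mem_univ _, hT S (Multiset.mem_toFinset.1 hS)⟩
    have hsum : ∑ S ∈ minimalVertexSeparators G, (edgeIntersections G T).count S • {S} =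
        edgeIntersections G T := by
      rw [← Finset.sum_subset hsub fun S _ hS => ?_]
      · exact Multiset.toFinset_sum_count_nsmul_eq _
      · rw [Multiset.count_eq_zero.2 fun h => hS (Multiset.mem_toFinset.2 h), zero_nsmul]
    rw [← edgeIntersections_eq]
    conv_lhs => rw [← hsum]
    rw [sum_map_multiset]
    refine Finset.sum_congr rfl fun S _ => ?_
    rw [Multiset.map_nsmul, Multiset.map_singleton, Multiset.nsmul_singleton]
    rfl

end QuasiThreshold

/-! ### The theorem -/

open QuasiThreshold SimpleGraph in
theorem theorem7 {V : Type*} [Fintype V] [DecidableEq V] (G : SimpleGraph V) [DecidableRel G.Adj]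
    (hconn : G.Connected) (hqt : QuasiThreshold.IsQuasiThreshold G) :
    -- a clique-tree exists, and all clique-trees define the same multiplicities
    (∃ T, QuasiThreshold.IsCliqueTree G T) ∧
    (∀ T T', QuasiThreshold.IsCliqueTree G T → QuasiThreshold.IsCliqueTree G T' →
      ∀ S, QuasiThreshold.multiplicity G T S = QuasiThreshold.multiplicity G T' S) ∧
    -- the nonzero Laplacian eigenvalues, with multiplicities
    (∀ T, QuasiThreshold.IsCliqueTree G T →
      (QuasiThreshold.laplacianEigenvalues G).filter (fun x => x ≠ 0) =
        (QuasiThreshold.nonSimplicial G).val.map (fun v => (G.degree v : ℝ) + 1)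
        + ∑ Q ∈ QuasiThreshold.maxCliques G,
            Multiset.replicate ((QuasiThreshold.simplicialIn G Q).card - 1) (Q.card : ℝ)
        + ∑ S ∈ QuasiThreshold.minimalVertexSeparators G,
            Multiset.replicate (QuasiThreshold.multiplicity G T S) (S.card : ℝ)) := by
  classical
  obtain ⟨-, h⟩ := hqt.exists_isJoinTree
  obtain ⟨ι, _, B, T₀, hB, hT₀, hchar⟩ := h
  have hT₁ : IsJoinTree Subtype.val (T₀.comap hB.equiv.symm) :=
    hB.comp_equiv_symm ▸ hT₀.comap hB.equiv.symm
  have huniq : ∀ T T', IsCliqueTree G T → IsCliqueTree G T' →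
      treeIntersections Subtype.val T = treeIntersections Subtype.val T' := fun T T' hT hT' =>
    (isCliqueTree_iff_isJoinTree.1 hT).treeIntersections_eq (isCliqueTree_iff_isJoinTree.1 hT')
  have henum : IsCliqueEnumeration G (Subtype.val : {Q : Finset V // IsMaxClique G Q} → _) := by
    refine ⟨fun Q => Q.2.1, fun K hK => ?_, fun Q Q' hQ => ?_⟩
    · obtain ⟨i, hi⟩ := hB.exists_subset K hK
      exact ⟨hB.equiv i, hi⟩
    · exact Subtype.ext (Finset.coe_injective (Q.2.eq_of_subset Q'.2.1 (by exact_mod_cast hQ)))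
  refine ⟨⟨_, isCliqueTree_iff_isJoinTree.2 hT₁⟩, fun T T' hT hT' S => ?_, fun T hT => ?_⟩
  · rw [QuasiThreshold.multiplicity, QuasiThreshold.multiplicity, edgeIntersections_eq, edgeIntersections_eq,
      huniq T T' hT hT']
  have hsep : ∀ S ∈ edgeIntersections G T, IsMinimalVertexSeparator G S := by
    intro S hS
    obtain ⟨s, hs, rfl⟩ := Multiset.mem_map.1 hS
    induction s with | _ Q Q' =>
    exact henum.isMinimalVertexSeparator (isCliqueTree_iff_isJoinTree.1 hT)
      (mem_edgeFinset.1 hs)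
  have hspec : cliqueTreeSpectrum G B T₀ = cliqueTreeSpectrum G Subtype.val T := by
    rw [← cliqueTreeSpectrum_comap G B T₀ hB.equiv.symm, hB.comp_equiv_symm, cliqueTreeSpectrum,
      cliqueTreeSpectrum, huniq _ T (isCliqueTree_iff_isJoinTree.2 hT₁) hT]
  have heig : laplacianEigenvalues G = 0 ::ₘ cliqueTreeSpectrum G B T₀ := by
    have h1 := (G.isHermitian_lapMatrix ℝ).roots_charpoly_eq_eigenvalues
    rw [hchar, Polynomial.roots_multiset_prod_X_sub_C] at h1
    exact h1.symm
  -- In a connected graph the empty set separates nothing.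
  have hne : ∀ S ∈ edgeIntersections G T, S.Nonempty := by
    intro S hS
    obtain ⟨u, v, ⟨-, -, hu, hv, hnr⟩, -⟩ := hsep S hS
    by_contra hcon
    rw [Finset.not_nonempty_iff_eq_empty] at hcon
    subst hcon
    refine hnr ?_
    obtain ⟨p⟩ := hconn u v
    exact ⟨p.induce _ fun k _ => by simp⟩
  have hfilter : (cliqueTreeSpectrum G Subtype.val T).filter (fun x => x ≠ 0) =
      cliqueTreeSpectrum G Subtype.val T := by
    rw [Multiset.filter_eq_self]
    intro x hx
    simp only [cliqueTreeSpectrum, Multiset.mem_add, Multiset.mem_map, Multiset.mem_sum,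
      Multiset.mem_replicate] at hx
    rcases hx with (⟨v, -, rfl⟩ | ⟨Q, -, hQ, rfl⟩) | ⟨S, hS, rfl⟩
    · positivity
    -- The value occurs, so the repetition count is nonzero; hence Q has simplicial vertices and is
    -- nonempty.
    · have : (simplicialIn G Q.1).card ≤ Q.1.card := Finset.card_filter_le _ _
      have : Q.1.card ≠ 0 := by omega
      exact_mod_cast this
    · exact_mod_cast (hne S hS).card_pos.ne'
  rw [heig, hspec]
  have := cliqueTreeSpectrum_val hsep
  rw [Multiset.filter_cons_of_neg _ (by simp)]
  convert hfilter.trans this
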